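/- Let $\mathbb D$ be the open unit disc in $\mathbb C$. For a domain $D\subset\mathbb C^n$ ($n\ge 1$), $z\in D$ and a nonempty at most countable set $A\subset D$, the Lempert function with pole set $A$ is $$l_D(A,z)=\inf\Big\{\prod_{a\in A}|\lambda_a|\Big\},$$ where the infimum is taken over all families $(\lambda_a)_{a\in A}$ of points of $\mathbb D$ for which there is a holomorphic map $\varphi:\mathbb D\to D$ with $\varphi(0)=z$ and $\varphi(\lambda_a)=a$ for all $a\in A$; write $l_D(a,z)=l_D(\{a\},z)$. For $N\in\mathbb N^*=\{1,2,\dots\}\cup\{\infty\}$ and $a,z\in D$ let $$l_D^N(a,z)=\inf\Big\{\prod_{j=1}^N|\lambda_j|\Big\},$$ where the infimum is taken over all families $(\lambda_j)_{j=1}^N$ of pairwise distinct points of $\mathbb D$ for which there is a holomorphic map $\varphi:\mathbb D\to D$ with $\varphi(0)=z$ and $\varphi(\lambda_j)=a$ for all $j$. (Infinite products of numbers in $[0,1)$ are the limits of their partial products, the value $0$ being allowed.) **Theorem 5.** Let $D\subset\mathbb C^n$ and $G\subset\mathbb C^m$ be domains, $z\in D$ and $w,b\in G$. Then for every nonempty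 at most countable set $A\subset D$, with $\#A\in\mathbb N^*$ denoting its number of elements, $$\max\{l_D(A,z),\,l_G^{\#A}(b,w)\}\le l_{D\times G}(A\times\{b\},(z,w))\le\max\{l_D(A,z),\,l_G(b,w)\}.$$ Moreover, for every given $N\in\mathbb N^*$, the equality $$l_{D\times G}(A\times\{b\},(z,w))=\max\{l_D(A,z),\,l_G(b,w)\}$$ holds for all at most countable $A\subset D$ with exactly $N$ elements (countably infinite $A$ if $N=\infty$) if and only if $l_G(b,w)=l_G^N(b,w)$. -/

import Mathlib

open Set Metric
open scoped ENNReal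

/-- `φ ∈ 𝓞(𝔻, D)`: the map `φ` is holomorphic on the open unit disc `𝔻` of `ℂ` and maps it into
`D`. (Only the values of `φ` on `𝔻` matter.) -/
def IsAnalyticDisc {E : Type*} [NormedAddCommGroup E] [NormedSpace ℂ E]
    (D : Set E) (φ : ℂ → E) : Prop :=
  DifferentiableOn ℂ φ (ball (0 : ℂ) 1) ∧ MapsTo φ (ball (0 : ℂ) 1) D

/-- For points of the unit disc, the possibly infinite product of their absolute values always
converges (the limit being `0` is allowed) and equals the infimum of its finite partial products,
so that the `∏'` in the definitions below is never a default value. -/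
theorem hasProd_norm_of_mem_unitDisc {ι : Type*} (lam : ι → ℂ)
    (h : ∀ i, lam i ∈ ball (0 : ℂ) 1) :
    HasProd (fun i => ‖lam i‖) (⨅ s : Finset ι, ∏ i ∈ s, ‖lam i‖) := by
  refine tendsto_atTop_ciInf ?_ ⟨0, ?_⟩
  · intro s t hst
    exact Finset.prod_le_prod_of_subset_of_le_one hst (fun i _ => norm_nonneg _)
      fun i _ _ => (mem_ball_zero_iff.mp (h i)).le
  · rintro _ ⟨s, rfl⟩
    exact Finset.prod_nonneg fun i _ => norm_nonneg _

/-- The Lempert function `l_D(A, z)` with pole set `A`: the infimum of `∏_{a ∈ A} |λ_a|` over all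
families `(λ_a)_{a ∈ A}` in the unit disc for which there is `φ ∈ 𝓞(𝔻, D)` with `φ(0) = z` and
`φ(λ_a) = a` for all `a ∈ A`. The infimum is taken in `[0, ∞]`. -/
noncomputable def lempert {E : Type*} [NormedAddCommGroup E] [NormedSpace ℂ E]
    (D A : Set E) (z : E) : ℝ≥0∞ :=
  sInf {r : ℝ≥0∞ | ∃ lam : A → ℂ, (∀ a, lam a ∈ ball (0 : ℂ) 1) ∧
    (∃ φ : ℂ → E, IsAnalyticDisc D φ ∧ φ 0 = z ∧ ∀ a : A, φ (lam a) = a) ∧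
    r = ENNReal.ofReal (∏' a : A, ‖lam a‖)}

/-- The function `l_D^N(a, z)`, `N ∈ {1, 2, …} ∪ {∞}`: the infimum of `∏_j |λ_j|` over all families
of `N` pairwise distinct points `λ_j` of the unit disc (a sequence if `N = ∞`) for which there is
`φ ∈ 𝓞(𝔻, D)` with `φ(0) = z` and `φ(λ_j) = a` for all `j`. The indices are the natural
numbers `j < N`. The infimum is taken in `[0, ∞]`. -/
noncomputable def lempertN {E : Type*} [NormedAddCommGroup E] [NormedSpace ℂ E]
    (N : ℕ∞) (D : Set E) (a z : E) : ℝ≥0∞ :=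
  sInf {r : ℝ≥0∞ | ∃ lam : {j : ℕ // (j : ℕ∞) < N} → ℂ, Function.Injective lam ∧
    (∀ j, lam j ∈ ball (0 : ℂ) 1) ∧
    (∃ φ : ℂ → E, IsAnalyticDisc D φ ∧ φ 0 = z ∧ ∀ j, φ (lam j) = a) ∧
    r = ENNReal.ofReal (∏' j, ‖lam j‖)}

/-!
The only substantial point is the upper bound for `l_{D × G}(A × {b}, (z, w))`. Let `φ` be a disc in
`D` with `φ 0 = z` and `φ (x a) = a` for `a ∈ A`, let `ψ` be a disc in `G` with `ψ 0 = w` and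
`ψ μ = b`, and let `max (∏ |x a|) |μ| < t < 1`. It suffices to find points `ν a` of the unit disc
with `∏ |ν a| ≤ t` and holomorphic self-maps `h`, `f` of the disc fixing `0` with `h (ν a) = x a` and
`f (ν a) = μ` (`exists_common_lift`), since `(φ ∘ h, ψ ∘ f)` is then a competitor.

* Given `ν`, the map `f` exists as soon as `|μ| ≤ ∏ |ν a|` (`exists_isAnalyticDisc_const_on`): it is
  a disc automorphism composed with a multiple of the Blaschke product with zeros `ν a`, whose
  value at `0` is `∏ |ν a|`.
* For `h` one takes the universal covering of the disc punctured at a point `exp l ∈ (0, 1)` outside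
  the countable family `x`, which may be rotated off the positive axis (`exists_rotation`). If all
  `x a` are nonzero, then, as `l` runs from `0` to `-∞`, the lift of `x a` given by the principal
  logarithm moves continuously from `x a` to the boundary. So if `F ⊆ A` is finite with
  `∏_{a ∈ F} |x a| < t`, some `l` makes the product over `F` of the moduli of the lifts equal to `t`;
  if some `x a = 0`, a deck translate of the base point does the same with `F = {a}`
  (`exists_finset_lift`). The remaining points have lifts arbitrarily close to the boundary
  (`exists_mem_fibre_near_boundary`), so they can be chosen to keep the whole product in `[|μ|, t]`.

The lower bound is obtained by projecting a disc in `D × G` to the two factors. Combined with the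
upper bound it yields the product formula when `l_G = l_G^N`. Conversely, a competitor `ψ` for
`l_G^N` and a small affine disc through `z` with the same parameters form a disc in `D × G`, so the
product formula gives `l_G ≤ l_G^N`; for poles on an affine disc that include `z` one has
`l_D(A, z) = 0`, and the lower bound gives `l_G^N ≤ l_G`.
-/

/-! ### Disc automorphisms -/

/-- The involutive automorphism of the unit disc that exchanges `0` and `a`, where `|a| < 1`. -/
noncomputable def discInvolution (a ζ : ℂ) : ℂ := (a - ζ) / (1 - starRingEnd ℂ a * ζ)

theorem one_sub_conj_mul_ne_zero {a ζ : ℂ} (ha : ‖a‖ < 1) (hζ : ‖ζ‖ < 1) :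
    1 - starRingEnd ℂ a * ζ ≠ 0 := by
  intro h
  have h1 : ‖starRingEnd ℂ a * ζ‖ = 1 := by rw [← sub_eq_zero.mp h, norm_one]
  rw [norm_mul, RCLike.norm_conj] at h1
  nlinarith [norm_nonneg a, norm_nonneg ζ]

theorem norm_discInvolution_lt_one {a ζ : ℂ} (ha : ‖a‖ < 1) (hζ : ‖ζ‖ < 1) :
    ‖discInvolution a ζ‖ < 1 := by
  have hne := one_sub_conj_mul_ne_zero ha hζ
  rw [discInvolution, norm_div, div_lt_one (norm_pos_iff.mpr hne)]
  refine lt_of_pow_lt_pow_left₀ 2 (norm_nonneg _) ?_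
  have ha' : ‖a‖ ^ 2 < 1 := by nlinarith [norm_nonneg a]
  have hζ' : ‖ζ‖ ^ 2 < 1 := by nlinarith [norm_nonneg ζ]
  rw [Complex.sq_norm, Complex.normSq_apply] at *
  simp only [Complex.sq_norm, Complex.normSq_apply, Complex.sub_re, Complex.sub_im, Complex.one_re,
    Complex.one_im, Complex.mul_re, Complex.mul_im, Complex.conj_re, Complex.conj_im] at *
  nlinarith [mul_pos (sub_pos.mpr ha') (sub_pos.mpr hζ')]

theorem discInvolution_discInvolution {a ζ : ℂ} (ha : ‖a‖ < 1) (hζ : ‖ζ‖ < 1) :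
    discInvolution a (discInvolution a ζ) = ζ := by
  have h1 := one_sub_conj_mul_ne_zero ha hζ
  have h2 := one_sub_conj_mul_ne_zero ha ha
  have h3 : 1 - starRingEnd ℂ a * ((a - ζ) / (1 - starRingEnd ℂ a * ζ)) ≠ 0 :=
    one_sub_conj_mul_ne_zero ha (norm_discInvolution_lt_one ha hζ)
  rw [discInvolution, discInvolution, div_eq_iff h3]
  linear_combination -div_mul_cancel₀ (a - ζ) h1

theorem discInvolution_self (a : ℂ) : discInvolution a a = 0 := by simp [discInvolution]

theorem discInvolution_zero (a : ℂ) : discInvolution a 0 = a := by simp [discInvolution]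

theorem discInvolution_ne_zero {a ζ : ℂ} (ha : ‖a‖ < 1) (hζ : ‖ζ‖ < 1) (h : ζ ≠ a) :
    discInvolution a ζ ≠ 0 :=
  div_ne_zero (sub_ne_zero.mpr h.symm) (one_sub_conj_mul_ne_zero ha hζ)

theorem differentiableOn_discInvolution {a : ℂ} (ha : ‖a‖ < 1) :
    DifferentiableOn ℂ (discInvolution a) (ball 0 1) := by
  refine DifferentiableOn.div (by fun_prop) (by fun_prop) fun ζ hζ => ?_
  exact one_sub_conj_mul_ne_zero ha (mem_ball_zero_iff.mp hζ)

theorem isAnalyticDisc_discInvolution {a : ℂ} (ha : ‖a‖ < 1) :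
    IsAnalyticDisc (ball (0 : ℂ) 1) (discInvolution a) :=
  ⟨differentiableOn_discInvolution ha, fun _ hζ => mem_ball_zero_iff.mpr
    (norm_discInvolution_lt_one ha (mem_ball_zero_iff.mp hζ))⟩

theorem IsAnalyticDisc.comp {E : Type*} [NormedAddCommGroup E] [NormedSpace ℂ E] {D : Set E}
    {φ : ℂ → E} {h : ℂ → ℂ} (hφ : IsAnalyticDisc D φ) (hh : IsAnalyticDisc (ball (0 : ℂ) 1) h) :
    IsAnalyticDisc D (φ ∘ h) :=
  ⟨hφ.1.comp hh.1 hh.2, hφ.2.comp hh.2⟩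

/-! ### Products of moduli of points of the disc -/

theorem tprod_norm_le_finset_prod {ι : Type*} {lam : ι → ℂ} (h : ∀ i, lam i ∈ ball (0 : ℂ) 1)
    (s : Finset ι) : ∏' i, ‖lam i‖ ≤ ∏ i ∈ s, ‖lam i‖ := by
  rw [(hasProd_norm_of_mem_unitDisc lam h).tprod_eq]
  refine ciInf_le ⟨0, ?_⟩ s
  rintro _ ⟨s, rfl⟩
  exact Finset.prod_nonneg fun i _ => norm_nonneg _

theorem le_tprod_norm {ι : Type*} {lam : ι → ℂ} (h : ∀ i, lam i ∈ ball (0 : ℂ) 1) {r : ℝ}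
    (hr : ∀ s : Finset ι, r ≤ ∏ i ∈ s, ‖lam i‖) : r ≤ ∏' i, ‖lam i‖ := by
  rw [(hasProd_norm_of_mem_unitDisc lam h).tprod_eq]
  exact le_ciInf hr

theorem exists_finset_prod_lt {ι : Type*} {lam : ι → ℂ} (h : ∀ i, lam i ∈ ball (0 : ℂ) 1) {r : ℝ}
    (hr : ∏' i, ‖lam i‖ < r) : ∃ s : Finset ι, ∏ i ∈ s, ‖lam i‖ < r := by
  by_contra! hc
  exact absurd (le_tprod_norm h hc) (not_le.mpr hr)

theorem tprod_norm_nonneg {ι : Type*} {lam : ι → ℂ} (h : ∀ i, lam i ∈ ball (0 : ℂ) 1) :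
    0 ≤ ∏' i, ‖lam i‖ :=
  le_tprod_norm h fun _ => Finset.prod_nonneg fun _ _ => norm_nonneg _

theorem tprod_norm_lt_one {ι : Type*} [Nonempty ι] {lam : ι → ℂ}
    (h : ∀ i, lam i ∈ ball (0 : ℂ) 1) : ∏' i, ‖lam i‖ < 1 := by
  inhabit ι
  refine (tprod_norm_le_finset_prod h {default}).trans_lt ?_
  simpa using h default

theorem tprod_norm_eq_zero {ι : Type*} {lam : ι → ℂ} (h : ∀ i, lam i ∈ ball (0 : ℂ) 1) {i : ι}
    (hi : lam i = 0) : ∏' i, ‖lam i‖ = 0 := by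
  refine le_antisymm ?_ (tprod_norm_nonneg h)
  simpa [hi] using tprod_norm_le_finset_prod h {i}

/-- If the product of the moduli is positive, the points satisfy the Blaschke condition. -/
theorem summable_one_sub_norm {ι : Type*} {lam : ι → ℂ} (h : ∀ i, lam i ∈ ball (0 : ℂ) 1)
    (hpos : 0 < ∏' i, ‖lam i‖) : Summable fun i => 1 - ‖lam i‖ := by
  have h1 : ∀ i, ‖lam i‖ < 1 := fun i => mem_ball_zero_iff.mp (h i)
  have h0 : ∀ i, 0 < ‖lam i‖ := fun i => by
    simpa using hpos.trans_le (tprod_norm_le_finset_prod h {i})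
  refine summable_of_sum_le (c := -Real.log (∏' i, ‖lam i‖)) (fun i => (sub_pos.mpr (h1 i)).le)
    fun s => ?_
  calc ∑ i ∈ s, (1 - ‖lam i‖) ≤ ∑ i ∈ s, -Real.log ‖lam i‖ := by
        refine Finset.sum_le_sum fun i _ => ?_
        linarith [Real.log_le_sub_one_of_pos (h0 i)]
    _ = -Real.log (∏ i ∈ s, ‖lam i‖) := by
        rw [Finset.sum_neg_distrib, Real.log_prod fun i _ => (h0 i).ne']
    _ ≤ _ := neg_le_neg (Real.log_le_log hpos (tprod_norm_le_finset_prod h s))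

/-- The Weierstrass product inequality. -/
theorem one_sub_sum_le_prod {ι : Type*} (s : Finset ι) {x δ : ι → ℝ} (hx0 : ∀ i, 0 ≤ x i)
    (hx1 : ∀ i, x i ≤ 1) (h : ∀ i ∈ s, 1 - δ i ≤ x i) : 1 - ∑ i ∈ s, δ i ≤ ∏ i ∈ s, x i := by
  classical
  have key : 1 - ∑ i ∈ s, (1 - x i) ≤ ∏ i ∈ s, x i := by
    clear h
    induction s using Finset.induction_on with
    | empty => simp
    | insert i s hi ih =>
      rw [Finset.sum_insert hi, Finset.prod_insert hi]
      have hp : ∏ j ∈ s, x j ≤ 1 := Finset.prod_le_one (fun j _ => hx0 j) fun j _ => hx1 j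
      nlinarith [hx0 i, hx1 i]
  have : ∑ i ∈ s, (1 - x i) ≤ ∑ i ∈ s, δ i :=
    Finset.sum_le_sum fun i hi => by linarith [h i hi]
  linarith

/-! ### Blaschke products -/

theorem norm_one_sub_blaschke_factor_le {a ζ : ℂ} {r : ℝ} (ha0 : a ≠ 0) (ha : ‖a‖ < 1)
    (hr : r < 1) (hζ : ‖ζ‖ ≤ r) :
    ‖(‖a‖ : ℂ) / a * discInvolution a ζ - 1‖ ≤ (1 - ‖a‖) * (2 / (1 - r)) := by
  have hne := one_sub_conj_mul_ne_zero ha (hζ.trans_lt hr)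
  have hsq : (‖a‖ : ℂ) ^ 2 = a * starRingEnd ℂ a := by
    rw [Complex.mul_conj, Complex.normSq_eq_norm_sq]; push_cast; rfl
  have e : (‖a‖ : ℂ) / a * discInvolution a ζ - 1 =
      (‖a‖ - 1) * ((1 + (‖a‖ / a) * ζ) / (1 - starRingEnd ℂ a * ζ)) := by
    rw [discInvolution, div_mul_div_comm, eq_comm, mul_div_assoc', eq_sub_iff_add_eq,
      div_add_one hne, div_eq_div_iff hne (mul_ne_zero ha0 hne)]
    field_simp
    linear_combination (1 - starRingEnd ℂ a * ζ) * ζ * hsq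
  have hu : ‖(‖a‖ : ℂ) / a‖ = 1 := by
    rw [norm_div, Complex.norm_real, norm_norm, div_self (norm_ne_zero_iff.mpr ha0)]
  rw [e, norm_mul, norm_div]
  have h1 : ‖(‖a‖ - 1 : ℂ)‖ = 1 - ‖a‖ := by
    rw [← Complex.ofReal_one, ← Complex.ofReal_sub, Complex.norm_real, Real.norm_eq_abs, abs_sub_comm,
      abs_of_pos (sub_pos.mpr ha)]
  rw [h1]
  have h2 : ‖1 + (‖a‖ / a : ℂ) * ζ‖ ≤ 2 := by
    refine (norm_add_le _ _).trans ?_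
    rw [norm_mul, hu, norm_one]
    linarith
  have h3 : 1 - r ≤ ‖1 - starRingEnd ℂ a * ζ‖ := by
    have := norm_sub_norm_le (1 : ℂ) (starRingEnd ℂ a * ζ)
    rw [norm_mul, RCLike.norm_conj, norm_one] at this
    nlinarith [norm_nonneg a, norm_nonneg ζ]
  have : 0 < 1 - r := sub_pos.mpr hr
  have : 0 ≤ 1 - ‖a‖ := (sub_pos.mpr ha).le
  gcongr

/-- The Blaschke product: a bounded holomorphic function on the disc vanishing at all the
given points, whose value at `0` is the product of their moduli. -/
theorem exists_blaschke_product {ι : Type*} [Nonempty ι] {ν : ι → ℂ}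
    (hν : ∀ i, ν i ∈ ball (0 : ℂ) 1) (hpos : 0 < ∏' i, ‖ν i‖) :
    ∃ B : ℂ → ℂ, IsAnalyticDisc (ball (0 : ℂ) 1) B ∧ B 0 = ((∏' i, ‖ν i‖ : ℝ) : ℂ) ∧
      ∀ i, B (ν i) = 0 := by
  have h1 : ∀ i, ‖ν i‖ < 1 := fun i => mem_ball_zero_iff.mp (hν i)
  have h0 : ∀ i, ν i ≠ 0 := fun i h => by simp [tprod_norm_eq_zero hν h] at hpos
  set b : ι → ℂ → ℂ := fun i ζ => (‖ν i‖ : ℂ) / ν i * discInvolution (ν i) ζ with hb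
  have hbd : ∀ i, DifferentiableOn ℂ (b i) (ball 0 1) := fun i =>
    (differentiableOn_discInvolution (h1 i)).const_mul _
  have hbn : ∀ i ζ, ‖ζ‖ < 1 → ‖b i ζ‖ < 1 := fun i ζ hζ => by
    rw [hb, norm_mul, norm_div, Complex.norm_real, norm_norm,
      div_self (norm_ne_zero_iff.mpr (h0 i)), one_mul]
    exact norm_discInvolution_lt_one (h1 i) hζ
  have hprod : HasProdLocallyUniformlyOn b (fun ζ => ∏' i, b i ζ) (ball 0 1) := by
    refine hasProdLocallyUniformlyOn_of_forall_compact isOpen_ball fun K hK hKc => ?_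
    obtain ⟨r, hr, hKr⟩ : ∃ r < 1, ∀ ζ ∈ K, ‖ζ‖ ≤ r := by
      rcases K.eq_empty_or_nonempty with rfl | hne
      · exact ⟨0, one_pos, by simp⟩
      · obtain ⟨ζ₀, hζ₀, hmax⟩ := hKc.exists_isMaxOn hne continuous_norm.continuousOn
        exact ⟨‖ζ₀‖, mem_ball_zero_iff.mp (hK hζ₀), fun ζ hζ => hmax hζ⟩
    have := ((summable_one_sub_norm hν hpos).mul_right (2 / (1 - r))).hasProdUniformlyOn_one_add
      (f := fun i ζ => b i ζ - 1) hKc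
      (.of_forall fun i ζ hζ => norm_one_sub_blaschke_factor_le (h0 i) (h1 i) hr (hKr ζ hζ))
      (fun i => ((hbd i).continuousOn.mono hK).sub continuousOn_const)
    simpa using this
  refine ⟨fun ζ => ∏' i, b i ζ, ⟨?_, fun ζ hζ => ?_⟩, ?_, fun i => ?_⟩
  · exact hprod.differentiableOn (.of_forall fun s => by
      simpa [Finset.prod_fn] using DifferentiableOn.finsetProd fun i _ => hbd i) isOpen_ball
  · -- the limit is bounded by any single factor, which has modulus less than `1`
    inhabit ι
    have hζ1 : ‖ζ‖ < 1 := mem_ball_zero_iff.mp hζ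
    have ht := (hprod.hasProd hζ).norm
    rw [mem_ball_zero_iff]
    refine lt_of_le_of_lt ?_ (hbn default ζ hζ1)
    refine le_of_tendsto ht ?_
    filter_upwards [Filter.eventually_ge_atTop {default}] with s hs
    have := Finset.prod_le_prod_of_subset_of_le_one (f := fun i => ‖b i ζ‖) hs
      (fun i _ => norm_nonneg _) fun i _ _ => (hbn i ζ hζ1).le
    simpa using this
  · have hz : ∀ i, b i 0 = ((‖ν i‖ : ℝ) : ℂ) := fun i => by
      rw [hb]; simp only [discInvolution_zero]; exact div_mul_cancel₀ _ (h0 i)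
    simp only [hz]
    have := (hasProd_norm_of_mem_unitDisc ν hν).multipliable.hasProd.map Complex.ofRealHom
      Complex.continuous_ofReal
    exact this.tprod_eq
  · refine tprod_of_exists_eq_zero ⟨i, ?_⟩
    simp [hb, discInvolution_self]

/-- A self-map of the disc fixing `0` may take the value `μ` at all points `ν i` as soon as
`|μ| ≤ ∏ |ν i|`. -/
theorem exists_isAnalyticDisc_const_on {ι : Type*} [Nonempty ι] {ν : ι → ℂ}
    (hν : ∀ i, ν i ∈ ball (0 : ℂ) 1) {μ : ℂ} (hμ : ‖μ‖ < 1) (h : ‖μ‖ ≤ ∏' i, ‖ν i‖) :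
    ∃ f : ℂ → ℂ, IsAnalyticDisc (ball (0 : ℂ) 1) f ∧ f 0 = 0 ∧ ∀ i, f (ν i) = μ := by
  rcases eq_or_ne μ 0 with rfl | hμ0
  · exact ⟨fun _ => 0, ⟨differentiableOn_const _, fun _ _ => by simp⟩, rfl, fun _ => rfl⟩
  have hpos : 0 < ∏' i, ‖ν i‖ := (norm_pos_iff.mpr hμ0).trans_le h
  obtain ⟨B, hB, hB0, hBν⟩ := exists_blaschke_product hν hpos
  set P := ∏' i, ‖ν i‖
  have hP : (P : ℂ) ≠ 0 := by exact_mod_cast hpos.ne'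
  have hc : ‖μ / P‖ ≤ 1 := by
    rw [norm_div, Complex.norm_real, Real.norm_of_nonneg hpos.le]
    exact (div_le_one hpos).mpr h
  have hg : IsAnalyticDisc (ball (0 : ℂ) 1) (fun ζ => μ / P * B ζ) := by
    refine ⟨hB.1.const_mul _, fun ζ hζ => ?_⟩
    have := mem_ball_zero_iff.mp (hB.2 hζ)
    rw [mem_ball_zero_iff, norm_mul]
    nlinarith [norm_nonneg (μ / P), norm_nonneg (B ζ)]
  refine ⟨_, (isAnalyticDisc_discInvolution hμ).comp hg, ?_, fun i => ?_⟩
  · simp [hB0, div_mul_cancel₀ _ hP, discInvolution_self]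
  · simp [hBν, discInvolution_zero]

open Filter Topology

/-! ### The universal covering of a once-punctured disc -/

/-- The Cayley transform of the left half-plane onto the disc that sends the negative real
number `l` to `0`. -/
noncomputable def leftCayley (l : ℝ) (s : ℂ) : ℂ := (s - l) / (s + l)

/-- The universal covering `ζ ↦ m (exp (l (1 + ζ) / (1 - ζ)))` of the unit disc punctured at
`exp l`, where `l < 0` and `m` exchanges `0` and `exp l`. It is normalized to fix `0`. -/
noncomputable def puncturedCover (l : ℝ) (ζ : ℂ) : ℂ :=
  discInvolution (Real.exp l : ℂ) (Complex.exp (l * ((1 + ζ) / (1 - ζ))))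

theorem norm_exp_ofReal_lt_one {l : ℝ} (hl : l < 0) : ‖(Real.exp l : ℂ)‖ < 1 := by
  rw [Complex.norm_real, Real.norm_of_nonneg (Real.exp_pos l).le]
  exact Real.exp_lt_one_iff.mpr hl

theorem add_ofReal_ne_zero {l : ℝ} {s : ℂ} (hl : l < 0) (hs : s.re < 0) : s + l ≠ 0 := by
  intro h
  have := congrArg Complex.re h
  simp at this
  linarith

theorem norm_leftCayley_lt_one {l : ℝ} {s : ℂ} (hl : l < 0) (hs : s.re < 0) :
    ‖leftCayley l s‖ < 1 := by
  rw [leftCayley, norm_div, div_lt_one (norm_pos_iff.mpr (add_ofReal_ne_zero hl hs))]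
  refine lt_of_pow_lt_pow_left₀ 2 (norm_nonneg _) ?_
  rw [Complex.sq_norm, Complex.sq_norm, Complex.normSq_apply, Complex.normSq_apply]
  simp only [Complex.sub_re, Complex.sub_im, Complex.add_re, Complex.add_im, Complex.ofReal_re,
    Complex.ofReal_im]
  nlinarith [mul_pos_of_neg_of_neg hl hs]

theorem one_sub_ne_zero_of_norm_lt_one {ζ : ℂ} (hζ : ‖ζ‖ < 1) : 1 - ζ ≠ 0 := by
  intro h
  rw [← sub_eq_zero.mp h, norm_one] at hζ
  exact lt_irrefl _ hζ

theorem re_one_add_div_one_sub_pos {ζ : ℂ} (hζ : ‖ζ‖ < 1) : 0 < ((1 + ζ) / (1 - ζ)).re := by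
  have hpos : 0 < Complex.normSq (1 - ζ) :=
    Complex.normSq_pos.mpr (one_sub_ne_zero_of_norm_lt_one hζ)
  have hζ' : ‖ζ‖ ^ 2 < 1 := by nlinarith [norm_nonneg ζ]
  rw [Complex.sq_norm, Complex.normSq_apply] at hζ'
  rw [Complex.div_re, ← add_div]
  refine div_pos ?_ hpos
  simp only [Complex.sub_re, Complex.sub_im, Complex.add_re, Complex.add_im, Complex.one_re,
    Complex.one_im]
  nlinarith

theorem isAnalyticDisc_puncturedCover {l : ℝ} (hl : l < 0) :
    IsAnalyticDisc (ball (0 : ℂ) 1) (puncturedCover l) := by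
  refine (isAnalyticDisc_discInvolution (norm_exp_ofReal_lt_one hl)).comp ⟨?_, fun ζ hζ => ?_⟩
  · refine DifferentiableOn.cexp (DifferentiableOn.const_mul ?_ _)
    refine DifferentiableOn.div (by fun_prop) (by fun_prop) fun ζ hζ => ?_
    exact one_sub_ne_zero_of_norm_lt_one (mem_ball_zero_iff.mp hζ)
  · rw [mem_ball_zero_iff, Complex.norm_exp, Complex.re_ofReal_mul]
    exact Real.exp_lt_one_iff.mpr
      (mul_neg_of_neg_of_pos hl (re_one_add_div_one_sub_pos (mem_ball_zero_iff.mp hζ)))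

theorem puncturedCover_zero (l : ℝ) : puncturedCover l 0 = 0 := by
  simp [puncturedCover, discInvolution_self]

theorem puncturedCover_leftCayley {l : ℝ} {s : ℂ} (hl : l < 0) (hs : s.re < 0) :
    puncturedCover l (leftCayley l s) = discInvolution (Real.exp l : ℂ) (Complex.exp s) := by
  have hne := add_ofReal_ne_zero hl hs
  have hl0 : (l : ℂ) ≠ 0 := by exact_mod_cast hl.ne
  have h1 : 1 - leftCayley l s = 2 * l / (s + l) := by
    rw [leftCayley, eq_div_iff hne, sub_mul, div_mul_cancel₀ _ hne]; ring
  have h2 : 1 + leftCayley l s = 2 * s / (s + l) := by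
    rw [leftCayley, eq_div_iff hne, add_mul, div_mul_cancel₀ _ hne]; ring
  have h3 : (l : ℂ) * ((1 + leftCayley l s) / (1 - leftCayley l s)) = s := by
    rw [h1, h2, div_div_div_cancel_right₀ hne]; field_simp
  rw [puncturedCover, h3]

/-- Every logarithm of `m x`, where `m` exchanges `0` and `exp l`, gives a point of the fibre of
the covering over `x`. -/
theorem leftCayley_mem_fibre {l : ℝ} {s x : ℂ} (hl : l < 0) (hx : ‖x‖ < 1)
    (hs : Complex.exp s = discInvolution (Real.exp l : ℂ) x) :
    leftCayley l s ∈ ball (0 : ℂ) 1 ∧ puncturedCover l (leftCayley l s) = x := by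
  have hc := norm_exp_ofReal_lt_one hl
  have hre : s.re < 0 := by
    have := norm_discInvolution_lt_one hc hx
    rwa [← hs, Complex.norm_exp, Real.exp_lt_one_iff] at this
  refine ⟨mem_ball_zero_iff.mpr (norm_leftCayley_lt_one hl hre), ?_⟩
  rw [puncturedCover_leftCayley hl hre, hs, discInvolution_discInvolution hc hx]

/-- The fibres of the covering accumulate at the boundary of the disc. -/
theorem exists_mem_fibre_near_boundary {l : ℝ} {x : ℂ} (hl : l < 0) (hx : ‖x‖ < 1)
    (hxl : x ≠ (Real.exp l : ℂ)) {δ : ℝ} (hδ : 0 < δ) :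
    ∃ ν ∈ ball (0 : ℂ) 1, puncturedCover l ν = x ∧ 1 - δ ≤ ‖ν‖ := by
  have hc := norm_exp_ofReal_lt_one hl
  set u := discInvolution (Real.exp l : ℂ) x with hu
  have hu0 : u ≠ 0 := discInvolution_ne_zero hc hx hxl
  let s : ℕ → ℂ := fun k => Complex.log u + k * (2 * Real.pi * Complex.I)
  have hs : ∀ k, Complex.exp (s k) = u := fun k => by
    rw [Complex.exp_add, Complex.exp_nat_mul_two_pi_mul_I, mul_one, Complex.exp_log hu0]
  have hsre : ∀ k, (s k).re < 0 := fun k => by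
    have := norm_discInvolution_lt_one hc hx
    rwa [← hu, ← hs k, Complex.norm_exp, Real.exp_lt_one_iff] at this
  have hlim : Tendsto (fun k => ‖leftCayley l (s k)‖) atTop (𝓝 1) := by
    have h1 : Tendsto (fun k : ℕ => s k + l) atTop (Bornology.cobounded ℂ) := by
      have h2 : Tendsto (fun k : ℕ => (k : ℂ) * (2 * Real.pi * Complex.I)) atTop
          (Bornology.cobounded ℂ) := by
        rw [← tendsto_norm_atTop_iff_cobounded]
        simp only [norm_mul, Complex.norm_natCast]
        exact tendsto_natCast_atTop_atTop.atTop_mul_const (by simp [Real.pi_ne_zero])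
      have := (tendsto_const_add_cobounded (Complex.log u + l)).comp h2
      refine this.congr fun k => ?_
      simp only [Function.comp, s]; ring
    have h3 : Tendsto (fun k => 1 - 2 * l * (s k + l)⁻¹) atTop (𝓝 (1 - 2 * l * 0)) :=
      tendsto_const_nhds.sub ((tendsto_inv₀_cobounded.comp h1).const_mul _)
    have h4 := h3.norm
    simp only [mul_zero, sub_zero, norm_one] at h4
    refine h4.congr fun k => ?_
    congr 1
    have := add_ofReal_ne_zero hl (hsre k)
    rw [leftCayley]
    field_simp
    ring
  obtain ⟨k, hk⟩ := (hlim.eventually (lt_mem_nhds (show 1 - δ < 1 by linarith))).exists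
  exact ⟨_, (leftCayley_mem_fibre hl hx (hs k)).1, (leftCayley_mem_fibre hl hx (hs k)).2, hk.le⟩

/-! ### A continuous branch of the fibre -/

/-- The point of the fibre of `puncturedCover l` over `x` given by the principal logarithm. -/
noncomputable def principalLift (x : ℂ) (l : ℝ) : ℂ :=
  leftCayley l (Complex.log (discInvolution (Real.exp l : ℂ) x))

theorem discInvolution_exp_mem_slitPlane {x : ℂ} {l : ℝ} (hl : l ≤ 0) (hx : ‖x‖ < 1)
    (hx' : -x ∈ Complex.slitPlane) :
    discInvolution (Real.exp l : ℂ) x ∈ Complex.slitPlane := by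
  set c := Real.exp l
  have hc0 : 0 < c := Real.exp_pos l
  have hc1 : c ≤ 1 := Real.exp_le_one_iff.mpr hl
  have hne : 1 - (c : ℂ) * x ≠ 0 := by
    refine one_sub_ne_zero_of_norm_lt_one ?_
    rw [norm_mul, Complex.norm_real, Real.norm_of_nonneg hc0.le]
    nlinarith [norm_nonneg x]
  have hpos : 0 < Complex.normSq (1 - (c : ℂ) * x) := Complex.normSq_pos.mpr hne
  have key : discInvolution (c : ℂ) x = ((Complex.normSq (1 - (c : ℂ) * x))⁻¹ : ℝ) *
      ((c - x) * starRingEnd ℂ (1 - (c : ℂ) * x)) := by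
    rw [discInvolution, Complex.conj_ofReal, div_eq_mul_inv, Complex.inv_def]
    push_cast; ring
  have hre : ((c - x) * starRingEnd ℂ (1 - (c : ℂ) * x)).re =
      c + c * (x.re ^ 2 + x.im ^ 2) - (1 + c ^ 2) * x.re := by
    simp; ring
  have him : ((c - x) * starRingEnd ℂ (1 - (c : ℂ) * x)).im = -(1 - c ^ 2) * x.im := by
    simp; ring
  rw [key, Complex.mem_slitPlane_iff, Complex.re_ofReal_mul, Complex.im_ofReal_mul, hre, him]
  rw [Complex.mem_slitPlane_iff, Complex.neg_re, Complex.neg_im] at hx'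
  have hi := inv_pos.mpr hpos
  rcases eq_or_ne x.im 0 with h0 | h0
  · left
    refine mul_pos hi ?_
    have : 0 < -x.re := hx'.resolve_right (by simp [h0])
    nlinarith [sq_nonneg x.re, sq_nonneg x.im, mul_pos hc0 hc0, mul_nonneg hc0.le (sq_nonneg x.re)]
  · rcases hc1.eq_or_lt with h1 | h1
    · left
      refine mul_pos hi ?_
      rw [h1]
      nlinarith [sq_nonneg (x.re - 1), sq_pos_of_ne_zero h0]
    · right
      refine mul_ne_zero hi.ne' (mul_ne_zero ?_ h0)
      nlinarith

theorem principalLift_mem_fibre {l : ℝ} {x : ℂ} (hl : l < 0) (hx : ‖x‖ < 1)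
    (hx' : -x ∈ Complex.slitPlane) :
    principalLift x l ∈ ball (0 : ℂ) 1 ∧ puncturedCover l (principalLift x l) = x :=
  leftCayley_mem_fibre hl hx (Complex.exp_log
    (Complex.slitPlane_ne_zero (discInvolution_exp_mem_slitPlane hl.le hx hx')))

theorem hasDerivAt_log_discInvolution {x : ℂ} (hx : ‖x‖ < 1) :
    HasDerivAt (fun l : ℝ => Complex.log (discInvolution (Real.exp l : ℂ) x))
      ((1 + x) / (1 - x)) 0 := by
  have hne := one_sub_ne_zero_of_norm_lt_one hx
  have he : HasDerivAt (fun l : ℝ => (Real.exp l : ℂ)) 1 0 := by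
    simpa using (Real.hasDerivAt_exp 0).ofReal_comp
  have hm : HasDerivAt (fun l : ℝ => discInvolution (Real.exp l : ℂ) x) ((1 + x) / (1 - x)) 0 := by
    simp only [discInvolution, Complex.conj_ofReal]
    have := (he.sub_const x).fun_div ((he.mul_const x).const_sub 1) (by simpa using hne)
    convert! this using 1
    simp only [Real.exp_zero, Complex.ofReal_one]
    field_simp
    ring
  have h1 : discInvolution (Real.exp 0 : ℂ) x = 1 := by simp [discInvolution, hne]
  have := hm.clog_real (by rw [h1]; exact Complex.one_mem_slitPlane)
  rwa [h1, div_one] at this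

theorem continuousOn_principalLift {x : ℂ} (hx : ‖x‖ < 1) (hx' : -x ∈ Complex.slitPlane) :
    ContinuousOn (principalLift x) (Iio 0) := by
  have hlog : ContinuousOn (fun l : ℝ => Complex.log (discInvolution (Real.exp l : ℂ) x))
      (Iio 0) := by
    refine ContinuousOn.clog ?_ fun l hl => discInvolution_exp_mem_slitPlane (le_of_lt hl) hx hx'
    refine ContinuousOn.div (by fun_prop) ?_ fun l hl =>
      one_sub_conj_mul_ne_zero (norm_exp_ofReal_lt_one hl) hx
    simp only [Complex.conj_ofReal]
    fun_prop
  refine ContinuousOn.div (hlog.sub (by fun_prop)) (hlog.add (by fun_prop)) fun l hl => ?_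
  refine add_ofReal_ne_zero hl ?_
  have := norm_discInvolution_lt_one (norm_exp_ofReal_lt_one hl) hx
  rwa [← Complex.exp_log (Complex.slitPlane_ne_zero
    (discInvolution_exp_mem_slitPlane (le_of_lt hl) hx hx')), Complex.norm_exp,
    Real.exp_lt_one_iff] at this

theorem leftCayley_eq_div {l : ℝ} (hl : l ≠ 0) (s : ℂ) :
    leftCayley l s = (s / l - 1) / (s / l + 1) := by
  have : (l : ℂ) ≠ 0 := by exact_mod_cast hl
  rw [leftCayley, div_sub_one this, div_add_one this, div_div_div_cancel_right₀ this]

/-- As the puncture moves to the boundary point `1`, the covering tends to the identity. -/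
theorem tendsto_principalLift_zero {x : ℂ} (hx : ‖x‖ < 1) :
    Tendsto (principalLift x) (𝓝[<] 0) (𝓝 x) := by
  have hne := one_sub_ne_zero_of_norm_lt_one hx
  have h := (hasDerivAt_log_discInvolution hx).tendsto_slope_zero_left
  have hq : Tendsto (fun l : ℝ => Complex.log (discInvolution (Real.exp l : ℂ) x) / l)
      (𝓝[<] 0) (𝓝 ((1 + x) / (1 - x))) := by
    refine h.congr fun l => ?_
    have h1 : discInvolution (Real.exp 0 : ℂ) x = 1 := by simp [discInvolution, hne]
    rw [h1]
    simp [div_eq_inv_mul]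
  have h2 : (1 + x) / (1 - x) + 1 ≠ 0 := by
    rw [div_add_one hne]
    refine div_ne_zero ?_ hne
    ring_nf
    norm_num
  have := (hq.sub_const 1).div (hq.add_const 1) h2
  have hval : ((1 + x) / (1 - x) - 1) / ((1 + x) / (1 - x) + 1) = x := by
    rw [div_eq_iff h2]
    field_simp
    ring
  rw [hval] at this
  refine this.congr' ?_
  filter_upwards [self_mem_nhdsWithin] with l hl
  exact (leftCayley_eq_div (ne_of_lt hl) _).symm

/-- As the puncture moves to the base point `0`, the fibres move to the boundary. -/
theorem tendsto_principalLift_atBot {x : ℂ} (hx' : -x ∈ Complex.slitPlane) :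
    Tendsto (principalLift x) atBot (𝓝 (-1)) := by
  have he : Tendsto (fun l : ℝ => (Real.exp l : ℂ)) atBot (𝓝 0) := by
    rw [← Complex.ofReal_zero]
    exact (Complex.continuous_ofReal.tendsto 0).comp Real.tendsto_exp_atBot
  have hm : Tendsto (fun l : ℝ => discInvolution (Real.exp l : ℂ) x) atBot (𝓝 (-x)) := by
    have := (he.sub_const x).div ((he.mul_const x).const_sub 1) (by simp)
    simp only [zero_sub, zero_mul, sub_zero, div_one] at this
    refine this.congr fun l => ?_
    simp only [discInvolution, Complex.conj_ofReal, Pi.div_apply]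
  have hi : Tendsto (fun l : ℝ => ((l⁻¹ : ℝ) : ℂ)) atBot (𝓝 0) := by
    rw [← Complex.ofReal_zero]
    exact (Complex.continuous_ofReal.tendsto 0).comp tendsto_inv_atBot_zero
  have hq := (hm.clog hx').mul hi
  rw [mul_zero] at hq
  have := (hq.sub_const 1).div (hq.add_const 1) (by simp)
  rw [zero_sub, zero_add, div_one] at this
  refine this.congr' ?_
  filter_upwards [eventually_lt_atBot 0] with l hl
  rw [principalLift, leftCayley_eq_div hl.ne, div_eq_mul_inv _ (l : ℂ), ← Complex.ofReal_inv,
    Pi.div_apply]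

/-- By the intermediate value theorem, the product of the moduli of finitely many principal lifts
takes every value between the product of the moduli of the points and `1`. -/
theorem exists_prod_norm_principalLift_eq {ι : Type*} (F : Finset ι) {x : ι → ℂ}
    (hx : ∀ i, ‖x i‖ < 1) (hx' : ∀ i, -x i ∈ Complex.slitPlane) {t : ℝ}
    (ht : ∏ i ∈ F, ‖x i‖ < t) (ht1 : t < 1) :
    ∃ l < 0, ∏ i ∈ F, ‖principalLift (x i) l‖ = t := by
  have hcont : ContinuousOn (fun l => ∏ i ∈ F, ‖principalLift (x i) l‖) (Iio 0) :=
    continuousOn_finsetProd F fun i _ => (continuousOn_principalLift (hx i) (hx' i)).norm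
  have h0 : Tendsto (fun l => ∏ i ∈ F, ‖principalLift (x i) l‖) (𝓝[<] 0) (𝓝 (∏ i ∈ F, ‖x i‖)) :=
    tendsto_finsetProd F fun i _ => (tendsto_principalLift_zero (hx i)).norm
  have h1 : Tendsto (fun l => ∏ i ∈ F, ‖principalLift (x i) l‖) atBot (𝓝 1) := by
    have := tendsto_finsetProd F fun i _ => (tendsto_principalLift_atBot (hx' i)).norm
    simpa using this
  obtain ⟨a, ha, ha0⟩ := ((h0.eventually (gt_mem_nhds ht)).and self_mem_nhdsWithin).exists
  obtain ⟨b, hb, hb0⟩ := ((h1.eventually (lt_mem_nhds ht1)).and (eventually_lt_atBot 0)).exists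
  obtain ⟨l, hl, hlt⟩ := isPreconnected_Iio.intermediate_value ha0 (mem_Iio.mpr hb0) hcont
    ⟨ha.le, hb.le⟩
  exact ⟨l, hl, hlt⟩

/-! ### Simultaneous lifting in the disc -/

/-- A countable family can be rotated off the positive real axis. -/
theorem exists_rotation {ι : Type*} [Countable ι] (x : ι → ℂ) :
    ∃ ω : ℂ, ‖ω‖ = 1 ∧ ∀ i, x i ≠ 0 → -(ω * x i) ∈ Complex.slitPlane := by
  -- choose a line through `0` that contains none of the nonzero points, and turn it onto `ℝ`
  obtain ⟨r, hr⟩ := ((countable_range fun i => (x i).im / (x i).re).dense_compl ℝ).nonempty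
  set v : ℂ := ⟨1, -r⟩ with hv
  have hv0 : v ≠ 0 := fun h => by simpa [hv] using congrArg Complex.re h
  have hn : ‖v‖ ≠ 0 := norm_ne_zero_iff.mpr hv0
  refine ⟨((‖v‖⁻¹ : ℝ) : ℂ) * v, ?_, fun i hi => ?_⟩
  · rw [norm_mul, Complex.norm_real, norm_inv, norm_norm, inv_mul_cancel₀ hn]
  · rw [Complex.mem_slitPlane_iff]
    right
    rw [Complex.neg_im, mul_assoc, Complex.im_ofReal_mul, neg_ne_zero]
    refine mul_ne_zero (inv_ne_zero hn) fun h => ?_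
    have h' : (x i).im = r * (x i).re := by
      simp only [hv, Complex.mul_im] at h
      linarith
    rcases eq_or_ne (x i).re 0 with h0 | h0
    · exact hi (Complex.ext h0 (by simpa [h0] using h'))
    · exact hr ⟨i, by simp only; rw [h', mul_div_cancel_right₀ _ h0]⟩

/-- For every `0 < t < 1` the puncture can be placed so that a deck translate of the base point `0`
has modulus `t`. -/
theorem exists_mem_fibre_zero {t : ℝ} (ht : 0 < t) (ht1 : t < 1) :
    ∃ l < 0, ∃ ν ∈ ball (0 : ℂ) 1, puncturedCover l ν = 0 ∧ ‖ν‖ = t := by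
  have h1 : 0 < 1 - t ^ 2 := by nlinarith
  -- `l` solves `π / √(l ^ 2 + π ^ 2) = t`, the left side being the modulus of the translate that
  -- corresponds to the logarithm `l + 2πi`
  set l : ℝ := -(Real.pi * Real.sqrt (1 - t ^ 2) / t) with hl
  have hl0 : l < 0 := by
    rw [hl, neg_lt_zero]
    have := Real.sqrt_pos.mpr h1
    positivity
  have hsq : l ^ 2 + Real.pi ^ 2 = (Real.pi / t) ^ 2 := by
    rw [hl, neg_sq, div_pow, mul_pow, Real.sq_sqrt h1.le]
    field_simp
    ring
  have hexp : Complex.exp ((l : ℂ) + 2 * Real.pi * Complex.I) =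
      discInvolution (Real.exp l : ℂ) 0 := by
    rw [discInvolution_zero, Complex.exp_add, Complex.exp_two_pi_mul_I, mul_one, Complex.ofReal_exp]
  obtain ⟨hb, hν⟩ := leftCayley_mem_fibre hl0 (by simp) hexp
  refine ⟨l, hl0, _, hb, hν, ?_⟩
  have hnum : ‖(l : ℂ) + 2 * Real.pi * Complex.I - l‖ = 2 * Real.pi := by
    rw [add_sub_cancel_left]
    simp [abs_of_pos Real.pi_pos]
  have hden : ‖(l : ℂ) + 2 * Real.pi * Complex.I + l‖ = 2 * (Real.pi / t) := by
    have h2 : 0 ≤ 2 * (Real.pi / t) := by positivity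
    rw [← sq_eq_sq₀ (norm_nonneg _) h2, mul_pow, ← hsq, Complex.sq_norm, Complex.normSq_apply]
    simp
    ring
  rw [leftCayley, norm_div, hnum, hden]
  have := Real.pi_pos
  field_simp

/-- Finitely many points can be lifted so that the moduli of the lifts have a prescribed
product. -/
theorem exists_finset_lift {ι : Type*} {x : ι → ℂ} (hx : ∀ i, x i ∈ ball (0 : ℂ) 1)
    (hx' : ∀ i, x i ≠ 0 → -x i ∈ Complex.slitPlane) {t : ℝ} (ht : ∏' i, ‖x i‖ < t) (ht1 : t < 1) :
    ∃ l < 0, ∃ (F : Finset ι) (ν : ι → ℂ),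
      (∀ i ∈ F, ν i ∈ ball (0 : ℂ) 1 ∧ puncturedCover l (ν i) = x i) ∧ ∏ i ∈ F, ‖ν i‖ = t := by
  have hx1 : ∀ i, ‖x i‖ < 1 := fun i => mem_ball_zero_iff.mp (hx i)
  by_cases h0 : ∃ i, x i = 0
  · obtain ⟨i, hi⟩ := h0
    obtain ⟨l, hl, ν, hν, hν0, hνt⟩ :=
      exists_mem_fibre_zero ((tprod_norm_nonneg hx).trans_lt ht) ht1
    refine ⟨l, hl, {i}, fun _ => ν, fun j hj => ?_, by simpa using hνt⟩
    rw [Finset.mem_singleton.mp hj, hi]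
    exact ⟨hν, hν0⟩
  · push Not at h0
    obtain ⟨F, hF⟩ := exists_finset_prod_lt hx ht
    obtain ⟨l, hl, hlt⟩ :=
      exists_prod_norm_principalLift_eq F hx1 (fun i => hx' i (h0 i)) hF ht1
    exact ⟨l, hl, F, fun i => principalLift (x i) l,
      fun i _ => principalLift_mem_fibre hl (hx1 i) (hx' i (h0 i)), hlt⟩

theorem exists_lift_of_mem_slitPlane {ι : Type*} [Countable ι] {x : ι → ℂ}
    (hx : ∀ i, x i ∈ ball (0 : ℂ) 1) (hx' : ∀ i, x i ≠ 0 → -x i ∈ Complex.slitPlane) {r t : ℝ}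
    (ht : ∏' i, ‖x i‖ < t) (hrt : r < t) (ht1 : t < 1) :
    ∃ ν : ι → ℂ, (∀ i, ν i ∈ ball (0 : ℂ) 1) ∧ r ≤ ∏' i, ‖ν i‖ ∧ ∏' i, ‖ν i‖ ≤ t ∧
      ∃ h : ℂ → ℂ, IsAnalyticDisc (ball (0 : ℂ) 1) h ∧ h 0 = 0 ∧ ∀ i, h (ν i) = x i := by
  classical
  have ht0 : 0 < t := (tprod_norm_nonneg hx).trans_lt ht
  obtain ⟨l, hl, F, ν₀, hν₀, hprod⟩ := exists_finset_lift hx hx' ht ht1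
  have hε : 0 < 1 - r / t := sub_pos.mpr ((div_lt_one ht0).mpr hrt)
  have := Encodable.ofCountable ι
  obtain ⟨δ, hδ0, c, hδc, hcε⟩ := posSumOfEncodable hε ι
  -- the points outside `F` are lifted so close to the boundary that they hardly contribute
  have hfar : ∀ i, ∃ ν ∈ ball (0 : ℂ) 1, puncturedCover l ν = x i ∧ 1 - δ i ≤ ‖ν‖ := fun i => by
    refine exists_mem_fibre_near_boundary hl (mem_ball_zero_iff.mp (hx i)) (fun h => ?_) (hδ0 i)
    have hne : x i ≠ 0 := by rw [h]; exact_mod_cast (Real.exp_pos l).ne'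
    have := hx' i hne
    rw [h, Complex.mem_slitPlane_iff, Complex.neg_re, Complex.neg_im, Complex.ofReal_re,
      Complex.ofReal_im] at this
    rcases this with h1 | h1
    · linarith [Real.exp_pos l]
    · simp at h1
  choose ν₁ hν₁ hν₁x hν₁δ using hfar
  set ν : ι → ℂ := fun i => if i ∈ F then ν₀ i else ν₁ i with hν
  have hνb : ∀ i, ν i ∈ ball (0 : ℂ) 1 := fun i => by
    by_cases hi : i ∈ F
    · simpa only [hν, if_pos hi] using (hν₀ i hi).1
    · simpa only [hν, if_neg hi] using hν₁ i
  have hνF : ∏ i ∈ F, ‖ν i‖ = t := by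
    rw [← hprod]
    exact Finset.prod_congr rfl fun i hi => by simp only [hν, if_pos hi]
  refine ⟨ν, hνb, le_tprod_norm hνb fun s => ?_, hνF ▸ tprod_norm_le_finset_prod hνb F,
    puncturedCover l, isAnalyticDisc_puncturedCover hl, puncturedCover_zero l, fun i => ?_⟩
  · have hν1 : ∀ i, ‖ν i‖ ≤ 1 := fun i => (mem_ball_zero_iff.mp (hνb i)).le
    have hsum : ∑ i ∈ s \ F, δ i ≤ 1 - r / t :=
      (sum_le_hasSum _ (fun i _ => (hδ0 i).le) hδc).trans hcε
    have hW : 1 - ∑ i ∈ s \ F, δ i ≤ ∏ i ∈ s \ F, ‖ν i‖ :=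
      one_sub_sum_le_prod _ (fun i => norm_nonneg _) hν1 fun i hi => by
        simpa only [hν, if_neg (Finset.mem_sdiff.mp hi).2] using hν₁δ i
    calc r = (r / t) * t := (div_mul_cancel₀ _ ht0.ne').symm
      _ ≤ (∏ i ∈ s \ F, ‖ν i‖) * ∏ i ∈ F, ‖ν i‖ := by
          rw [hνF]
          exact mul_le_mul_of_nonneg_right (by linarith) ht0.le
      _ = ∏ i ∈ s ∪ F, ‖ν i‖ := by
          rw [← Finset.prod_union Finset.sdiff_disjoint, Finset.sdiff_union_self_eq_union]
      _ ≤ ∏ i ∈ s, ‖ν i‖ := Finset.prod_le_prod_of_subset_of_le_one Finset.subset_union_left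
          (fun i _ => norm_nonneg _) fun i _ _ => hν1 i
  · by_cases hi : i ∈ F
    · simpa only [hν, if_pos hi] using (hν₀ i hi).2
    · simpa only [hν, if_neg hi] using hν₁x i

/-- The product property in the bidisc: if `∏ |x i|` and `|μ|` are less than `t < 1`, there
are points `ν i` with `∏ |ν i| ≤ t` and a holomorphic map `(h, f)` of the disc into the bidisc,
sending `0` to the origin, with `(h, f) (ν i) = (x i, μ)`. -/
theorem exists_common_lift {ι : Type*} [Nonempty ι] [Countable ι] {x : ι → ℂ}
    (hx : ∀ i, x i ∈ ball (0 : ℂ) 1) {μ : ℂ} {t : ℝ} (ht : ∏' i, ‖x i‖ < t) (hμ : ‖μ‖ < t)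
    (ht1 : t < 1) :
    ∃ ν : ι → ℂ, (∀ i, ν i ∈ ball (0 : ℂ) 1) ∧ ∏' i, ‖ν i‖ ≤ t ∧
      (∃ h : ℂ → ℂ, IsAnalyticDisc (ball (0 : ℂ) 1) h ∧ h 0 = 0 ∧ ∀ i, h (ν i) = x i) ∧
      ∃ f : ℂ → ℂ, IsAnalyticDisc (ball (0 : ℂ) 1) f ∧ f 0 = 0 ∧ ∀ i, f (ν i) = μ := by
  obtain ⟨ω, hω, hωx⟩ := exists_rotation x
  have hω0 : ω ≠ 0 := norm_ne_zero_iff.mp (by rw [hω]; exact one_ne_zero)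
  obtain ⟨ν, hν, hμν, hνt, h, hh, hh0, hhν⟩ := exists_lift_of_mem_slitPlane
    (x := fun i => ω * x i) (r := ‖μ‖) (t := t)
    (fun i => by simpa [hω] using hx i) (fun i hi => hωx i (right_ne_zero_of_mul hi))
    (by simpa [hω] using ht) hμ ht1
  refine ⟨ν, hν, hνt, ⟨fun ζ => ω⁻¹ * h ζ, ⟨hh.1.const_mul _, fun ζ hζ => ?_⟩, by simp [hh0],
    fun i => by simp only [hhν]; exact inv_mul_cancel_left₀ hω0 _⟩,
    exists_isAnalyticDisc_const_on hν (hμ.trans ht1) hμν⟩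
  simpa [hω] using hh.2 hζ

/-! ### Comparison of the Lempert functions -/

section Comparison

variable {E E' : Type*} [NormedAddCommGroup E] [NormedSpace ℂ E]
  [NormedAddCommGroup E'] [NormedSpace ℂ E']

theorem lempert_le {D A : Set E} {z : E} {lam : A → ℂ} (hlam : ∀ a, lam a ∈ ball (0 : ℂ) 1)
    {φ : ℂ → E} (hφ : IsAnalyticDisc D φ) (h0 : φ 0 = z) (ha : ∀ a : A, φ (lam a) = a) :
    lempert D A z ≤ ENNReal.ofReal (∏' a, ‖lam a‖) :=
  sInf_le ⟨lam, hlam, ⟨φ, hφ, h0, ha⟩, rfl⟩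

/-- The bijection `a ↦ (a, b)` of `A` onto `A × {b}`. -/
def prodSingletonEquiv {α β : Type*} (A : Set α) (b : β) : A ≃ (A ×ˢ {b} : Set (α × β)) where
  toFun a := ⟨(a, b), a.2, rfl⟩
  invFun p := ⟨p.1.1, p.2.1⟩
  left_inv _ := rfl
  right_inv := by
    rintro ⟨⟨p, q⟩, hp, hq⟩
    exact Subtype.ext (Prod.ext rfl (mem_singleton_iff.mp hq).symm)

/-- The poles of a product `A × {b}` may be indexed by `A`. -/
theorem lempert_prod_singleton_le {D A : Set E} {G : Set E'} {z : E} {w b : E'} {lam : A → ℂ}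
    (hlam : ∀ a, lam a ∈ ball (0 : ℂ) 1) {φ : ℂ → E} {ψ : ℂ → E'} (hφ : IsAnalyticDisc D φ)
    (hψ : IsAnalyticDisc G ψ) (hφ0 : φ 0 = z) (hψ0 : ψ 0 = w) (hφa : ∀ a : A, φ (lam a) = a)
    (hψa : ∀ a : A, ψ (lam a) = b) :
    lempert (D ×ˢ G) (A ×ˢ {b}) (z, w) ≤ ENNReal.ofReal (∏' a, ‖lam a‖) := by
  rw [← (prodSingletonEquiv A b).symm.tprod_eq fun a => ‖lam a‖]
  refine lempert_le (lam := fun p => lam ((prodSingletonEquiv A b).symm p)) (fun p => hlam _)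
    (φ := fun ζ => (φ ζ, ψ ζ))
    ⟨hφ.1.prodMk hψ.1, fun ζ hζ => ⟨hφ.2 hζ, hψ.2 hζ⟩⟩ (by rw [hφ0, hψ0]) fun p => ?_
  exact Prod.ext (hφa _) ((hψa _).trans (mem_singleton_iff.mp p.2.2).symm)

theorem lempert_prod_le_max {D A : Set E} {G : Set E'} (z : E) (w b : E') (hA : A.Nonempty)
    (hAc : A.Countable) :
    lempert (D ×ˢ G) (A ×ˢ {b}) (z, w) ≤ max (lempert D A z) (lempert G {b} w) := by
  have := hA.to_subtype
  have := hAc.to_subtype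
  refine le_of_forall_gt fun c hc => ?_
  obtain ⟨hc1, hc2⟩ := max_lt_iff.mp hc
  obtain ⟨_, ⟨lam, hlam, ⟨φ, hφ, hφ0, hφa⟩, rfl⟩, h1⟩ := sInf_lt_iff.mp hc1
  obtain ⟨_, ⟨mu, hmu, ⟨ψ, hψ, hψ0, hψb⟩, rfl⟩, h2⟩ := sInf_lt_iff.mp hc2
  set L := ∏' a, ‖lam a‖
  set μ := mu ⟨b, rfl⟩ with hμ
  have hM : ∏' a, ‖mu a‖ = ‖μ‖ := by
    rw [tprod_eq_prod (s := {⟨b, rfl⟩}) fun a ha => absurd (Subsingleton.elim _ _) (by simpa using ha),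
      Finset.prod_singleton]
  rw [hM] at h2
  have hmax : max L ‖μ‖ < 1 := max_lt (tprod_norm_lt_one hlam) (mem_ball_zero_iff.mp (hmu _))
  refine lt_of_le_of_lt (b := ENNReal.ofReal (max L ‖μ‖)) ?_ ?_
  · refine ge_of_tendsto (x := 𝓝[>] (max L ‖μ‖))
      ((ENNReal.continuous_ofReal.tendsto _).mono_left nhdsWithin_le_nhds) ?_
    filter_upwards [Ioo_mem_nhdsGT hmax] with t ht
    obtain ⟨ν, hν, hνt, ⟨h, hh, hh0, hhν⟩, f, hf, hf0, hfν⟩ := exists_common_lift hlam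
      ((le_max_left _ _).trans_lt ht.1) ((le_max_right _ _).trans_lt ht.1) ht.2
    refine (lempert_prod_singleton_le hν (hφ.comp hh) (hψ.comp hf) ?_ ?_ (fun a => ?_)
      fun a => ?_).trans (ENNReal.ofReal_le_ofReal hνt)
    · simp [hh0, hφ0]
    · simp [hf0, hψ0]
    · simp [hhν, hφa]
    · simpa [hfν] using hψb ⟨b, rfl⟩
  · rw [ENNReal.ofReal_max]
    exact max_lt h1 h2

theorem enatCard_subtype_natCast_lt (N : ℕ∞) : ENat.card {j : ℕ // (j : ℕ∞) < N} = N := by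
  induction N using ENat.recTopCoe with
  | top =>
    have : Infinite {j : ℕ // (j : ℕ∞) < ⊤} :=
      Infinite.of_injective (fun j : ℕ => ⟨j, ENat.natCast_lt_top j⟩) fun i j h => congrArg Subtype.val h
    exact ENat.card_eq_top_of_infinite
  | coe k =>
    rw [← ENat.card_congr (Fin.equivSubtype.trans (Equiv.subtypeEquivRight fun j => Nat.cast_lt.symm))]
    simp

theorem nonempty_equiv_of_encard_eq {α : Type*} {A : Set α} (hA : A.Countable) {N : ℕ∞}
    (h : A.encard = N) : Nonempty ({j : ℕ // (j : ℕ∞) < N} ≃ A) := by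
  have hcard : ENat.card {j : ℕ // (j : ℕ∞) < N} = ENat.card A :=
    (enatCard_subtype_natCast_lt N).trans h.symm
  refine Cardinal.lift_mk_eq'.mp (Cardinal.toENat_injOn ?_ ?_ ?_)
  · simp
  · simpa using hA.to_subtype
  · simpa only [Cardinal.toENat_lift, ENat.card] using hcard

theorem lempertN_le_lempert_prod {D A : Set E} {G : Set E'} (z : E) (w b : E')
    (hAc : A.Countable) {N : ℕ∞} (hN : A.encard = N) :
    lempertN N G b w ≤ lempert (D ×ˢ G) (A ×ˢ {b}) (z, w) := by
  obtain ⟨e⟩ := nonempty_equiv_of_encard_eq hAc hN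
  refine le_sInf ?_
  rintro _ ⟨lam, hlam, ⟨φ, hφ, hφ0, hφa⟩, rfl⟩
  rw [← (e.trans (prodSingletonEquiv A b)).tprod_eq fun a => ‖lam a‖]
  refine sInf_le ⟨fun j => lam (prodSingletonEquiv A b (e j)), fun i j hij => ?_, fun j => hlam _,
    ⟨fun ζ => (φ ζ).2, ⟨hφ.1.snd, fun ζ hζ => (hφ.2 hζ).2⟩, by simp [hφ0], fun j => ?_⟩, rfl⟩
  · refine (e.trans (prodSingletonEquiv A b)).injective (Subtype.ext ?_)
    exact (hφa _).symm.trans ((congrArg φ hij).trans (hφa _))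
  · simp [hφa, prodSingletonEquiv]

theorem lempert_le_lempert_prod {D A : Set E} {G : Set E'} (z : E) (w b : E') :
    lempert D A z ≤ lempert (D ×ˢ G) (A ×ˢ {b}) (z, w) := by
  refine le_sInf ?_
  rintro _ ⟨lam, hlam, ⟨φ, hφ, hφ0, hφa⟩, rfl⟩
  rw [← (prodSingletonEquiv A b).tprod_eq fun a => ‖lam a‖]
  refine lempert_le (fun a => hlam _) (φ := fun ζ => (φ ζ).1)
    ⟨hφ.1.fst, fun ζ hζ => (hφ.2 hζ).1⟩ (by simp [hφ0]) fun a => ?_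
  simp [hφa, prodSingletonEquiv]

/-- Any `N` distinct points of the disc parametrize, by a small affine disc through `z`, a set of
`N` poles in `D`. -/
theorem exists_poles_on_affine_disc [Nontrivial E] {D : Set E} (hD : IsOpen D) {z : E} (hz : z ∈ D)
    {N : ℕ∞} {lam : {j : ℕ // (j : ℕ∞) < N} → ℂ} (hinj : Function.Injective lam)
    (hlam : ∀ j, lam j ∈ ball (0 : ℂ) 1) :
    ∃ A ⊆ D, A.Countable ∧ A.encard = N ∧ ∃ (e : A ≃ {j : ℕ // (j : ℕ∞) < N}) (φ : ℂ → E),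
      IsAnalyticDisc D φ ∧ φ 0 = z ∧ ∀ a, φ (lam (e a)) = a := by
  obtain ⟨v, hv⟩ := exists_ne (0 : E)
  obtain ⟨r, hr, hrD⟩ := Metric.isOpen_iff.mp hD z hz
  have hv0 : 0 < ‖v‖ := norm_pos_iff.mpr hv
  set φ : ℂ → E := fun ζ => z + ((r / ‖v‖ : ℝ) : ℂ) • ζ • v with hφ
  have hc : ((r / ‖v‖ : ℝ) : ℂ) ≠ 0 := by exact_mod_cast (div_pos hr hv0).ne'
  have hφD : IsAnalyticDisc D φ := by
    refine ⟨Differentiable.differentiableOn (by fun_prop), fun ζ hζ => hrD ?_⟩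
    rw [mem_ball_iff_norm, hφ, add_sub_cancel_left, norm_smul, norm_smul, Complex.norm_real,
      Real.norm_of_nonneg (div_pos hr hv0).le]
    have : r / ‖v‖ * (‖ζ‖ * ‖v‖) = r * ‖ζ‖ := by field_simp
    rw [this]
    exact mul_lt_of_lt_one_right hr (mem_ball_zero_iff.mp hζ)
  have hφinj : Function.Injective fun j => φ (lam j) := fun i j hij =>
    hinj (smul_left_injective ℂ hv (smul_right_injective E hc (add_left_cancel hij)))
  refine ⟨range fun j => φ (lam j), ?_, countable_range _, ?_,
    (Equiv.ofInjective _ hφinj).symm, φ, hφD, by simp [hφ], fun a => ?_⟩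
  · rintro _ ⟨j, rfl⟩
    exact hφD.2 (hlam j)
  · exact (ENat.card_congr (Equiv.ofInjective _ hφinj).symm).trans (enatCard_subtype_natCast_lt N)
  · exact congrArg Subtype.val ((Equiv.ofInjective _ hφinj).apply_symm_apply a)

/-- There are `N` distinct points of the disc that include the origin. -/
theorem exists_injective_disc_zero {N : ℕ∞} (hN : 1 ≤ N) :
    ∃ lam : {j : ℕ // (j : ℕ∞) < N} → ℂ, Function.Injective lam ∧
      (∀ j, lam j ∈ ball (0 : ℂ) 1) ∧ ∃ j, lam j = 0 := by
  refine ⟨fun j => ((1 - 1 / ((j : ℕ) + 1) : ℝ) : ℂ), fun i j hij => ?_, fun j => ?_,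
    ⟨0, by simpa using Order.one_le_iff_ne_zero.mp hN |>.bot_lt⟩, by simp⟩
  · have h1 : (1 : ℝ) / ((i : ℕ) + 1) = 1 / ((j : ℕ) + 1) := by
      have := Complex.ofReal_injective hij
      linarith
    rw [one_div, one_div, inv_inj] at h1
    exact Subtype.ext (by exact_mod_cast add_right_cancel h1)
  · have hp : (0 : ℝ) < (j : ℕ) + 1 := by positivity
    have h1 : (1 : ℝ) / ((j : ℕ) + 1) ≤ 1 := (div_le_one hp).mpr (by simp)
    have h2 : (0 : ℝ) < 1 / ((j : ℕ) + 1) := by positivity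
    rw [mem_ball_zero_iff, Complex.norm_real, Real.norm_of_nonneg (by linarith)]
    linarith

/-- If the product formula holds for all sets of `N` poles, then `l_G = l_G^N`. -/
theorem lempert_eq_lempertN_of_forall [Nontrivial E] {D : Set E} (hD : IsOpen D) {G : Set E'}
    {z : E} (hz : z ∈ D) {w b : E'} {N : ℕ∞} (hN : 1 ≤ N)
    (h : ∀ A : Set E, A ⊆ D → A.Countable → A.encard = N →
      lempert (D ×ˢ G) (A ×ˢ {b}) (z, w) = max (lempert D A z) (lempert G {b} w)) :
    lempert G {b} w = lempertN N G b w := by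
  refine le_antisymm (le_sInf ?_) ?_
  · -- a competitor `ψ` for `l_G^N` is paired with an affine disc having the same parameters
    rintro _ ⟨lam, hinj, hlam, ⟨ψ, hψ, hψ0, hψb⟩, rfl⟩
    obtain ⟨A, hA, hAc, hAN, e, φ, hφ, hφ0, hφa⟩ := exists_poles_on_affine_disc hD hz hinj hlam
    calc lempert G {b} w ≤ max (lempert D A z) (lempert G {b} w) := le_max_right _ _
      _ = lempert (D ×ˢ G) (A ×ˢ {b}) (z, w) := (h A hA hAc hAN).symm
      _ ≤ ENNReal.ofReal (∏' a, ‖lam (e a)‖) :=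
        lempert_prod_singleton_le (fun a => hlam _) hφ hψ hφ0 hψ0 hφa fun a => hψb _
      _ = _ := by rw [e.tprod_eq fun j => ‖lam j‖]
  · -- for poles on an affine disc that include `z`, the Lempert function of `D` vanishes
    obtain ⟨lam, hinj, hlam, j, hj⟩ := exists_injective_disc_zero hN
    obtain ⟨A, hA, hAc, hAN, e, φ, hφ, hφ0, hφa⟩ := exists_poles_on_affine_disc hD hz hinj hlam
    have h0 : lempert D A z = 0 := by
      have := lempert_le (fun a => hlam (e a)) hφ hφ0 hφa
      rw [e.tprod_eq fun j => ‖lam j‖, tprod_norm_eq_zero hlam hj, ENNReal.ofReal_zero] at this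
      exact le_antisymm this bot_le
    calc lempertN N G b w ≤ lempert (D ×ˢ G) (A ×ˢ {b}) (z, w) :=
          lempertN_le_lempert_prod z w b hAc hAN
      _ = max (lempert D A z) (lempert G {b} w) := h A hA hAc hAN
      _ = lempert G {b} w := by rw [h0]; exact max_eq_right bot_le

end Comparison

/-! ### The product theorem -/

theorem theorem5 {n m : ℕ} (hn : 0 < n)
    (D : Set (EuclideanSpace ℂ (Fin n))) (G : Set (EuclideanSpace ℂ (Fin m)))
    (hDo : IsOpen D) (hDc : IsConnected D) (hGo : IsOpen G) (hGc : IsConnected G)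
    (z : EuclideanSpace ℂ (Fin n)) (hz : z ∈ D)
    (w b : EuclideanSpace ℂ (Fin m)) (hw : w ∈ G) (hb : b ∈ G) :
    (∀ A : Set (EuclideanSpace ℂ (Fin n)), A ⊆ D → A.Nonempty → A.Countable →
      max (lempert D A z) (lempertN A.encard G b w) ≤ lempert (D ×ˢ G) (A ×ˢ {b}) (z, w) ∧
      lempert (D ×ˢ G) (A ×ˢ {b}) (z, w) ≤ max (lempert D A z) (lempert G {b} w)) ∧
    (∀ N : ℕ∞, 1 ≤ N →
      ((∀ A : Set (EuclideanSpace ℂ (Fin n)), A ⊆ D → A.Countable → A.encard = N →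
          lempert (D ×ˢ G) (A ×ˢ {b}) (z, w) = max (lempert D A z) (lempert G {b} w)) ↔
        lempert G {b} w = lempertN N G b w)) := by
  have : Nonempty (Fin n) := ⟨⟨0, hn⟩⟩
  have hlower : ∀ A : Set (EuclideanSpace ℂ (Fin n)), A.Countable →
      max (lempert D A z) (lempertN A.encard G b w) ≤ lempert (D ×ˢ G) (A ×ˢ {b}) (z, w) :=
    fun A hAc => max_le (lempert_le_lempert_prod z w b) (lempertN_le_lempert_prod z w b hAc rfl)
  refine ⟨fun A _ hA hAc => ⟨hlower A hAc, lempert_prod_le_max z w b hA hAc⟩, fun N hN =>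
    ⟨lempert_eq_lempertN_of_forall hDo hz hN, fun h A hAD hAc hAN => ?_⟩⟩
  have hA : A.Nonempty := by
    rw [← encard_ne_zero, hAN]
    exact Order.one_le_iff_ne_zero.mp hN
  refine le_antisymm (lempert_prod_le_max z w b hA hAc) ?_
  have := hlower A hAc
  rwa [hAN, ← h] at this
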